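/- Let $K$ be a subfield of $\mathbb{C}$ (for instance $K=\mathbb{R}$ or $K=\mathbb{C}$), and let $\mathcal X=(x_1,\dots,x_7)$ and $\mathcal Y=(y_1,\dots,y_7)$ be two $7$-tuples of points of $\mathbb{P}^2(K)$. A flatland camera over $K$ is a $2\times 3$ matrix over $K$ of rank $2$, and its center is the point of $\mathbb{P}^2(K)$ spanned by its kernel. Call $(a,b)\in\mathbb{P}^2(K)\times\mathbb{P}^2(K)$ a center pair if there are flatland cameras $A,B$ over $K$ with centers $a,b$ such that, for every $i$, $Ax_i$ and $By_i$ are nonzero and equal up to a nonzero scalar. The camera centers variety $\mathcal E=\mathcal E_{\mathcal X,\mathcal Y}\subset\mathbb{P}^2(\mathbb{C})\times\mathbb{P}^2(\mathbb{C})$ is the set of all $(a,b)$ for which there is a nonzero complex $3\times 3$ matrix $F$ with $Fa=0$, $F^{T}b=0$ and $y_i^{T}Fx_i=0$ for $i=1,\dots,7$. Let $L$ be the $K$-vector space of all $3\times 3$ matrices $F$ over $K$ with $y_i^TFx_i=0$ for $i=1,\dots,7$. There is a nonempty Zariski open set of pairs $(\mathcal X,\mathcal Y)$ (the configurations having homogeneous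 coordinates at which a certain nonzero polynomial over $K$ in these coordinates does not vanish) such that, for every $(\mathcal X,\mathcal Y)$ in it, the following hold. 1. $\dim_K L=2$. For any basis $F_1,F_2$ of $L$, the three coordinates of $F_1a\times F_2a$ (as quadratic forms in $a$) define three distinct plane conics $\omega_{a,1},\omega_{a,2},\omega_{a,3}$, and the three coordinates of $F_1^{T}b\times F_2^{T}b$ define three distinct plane conics $\omega_{b,1},\omega_{b,2},\omega_{b,3}$. If $(a,b)$ is a center pair, or a point of $\mathcal E$, then $a\in\bigcap_i\omega_{a,i}$ and $b\in\bigcap_i\omega_{b,i}$. 2. Each triple of conics meets in exactly three complex points: $$\#\bigcap_{i=1}^3\omega_{a,i}=\#\bigcap_{i=1}^3\omega_{b,i}=3 .$$ 3. Each center determines the other: for every complex point $a\in\bigcap_i\omega_{a,i}$ there is exactly one $b$ with $(a,b)\in\mathcal E$, and for every complex point $b\in\bigcap_i\omega_{b,i}$ there is exactly one $a$ with $(a,b)\in\mathcal E$; if $(a,b)$ and $(a,b')$ are center pairs then $b=b'$, and if $(a,b)$ and $(a',b)$ are center pairs then $a=a'$. 4. Every center pair lies in $\mathcal E$; the variety $\mathcal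 E$ consists of exactly three points, its multidegree $d_{(0,0)}(\mathcal E)$ (the number of points in which it meets $0$ generic lines of the first plane and $0$ generic lines of the second) is $3$, and there are at most three center pairs $(a,b)$. -/

import Mathlib

open scoped Matrix LinearAlgebra.Projectivization

namespace FlatlandCameras

/-- The projective plane over `K`. -/
abbrev Plane (K : Type*) [Field K] : Type _ := ℙ K (Fin 3 → K)

/-- The point of the complex projective plane with the same homogeneous coordinates. -/
noncomputable def toComplex {K : Type*} [Field K] [Algebra K ℂ] (p : Plane K) : Plane ℂ :=
  Projectivization.mk ℂ (fun j => algebraMap K ℂ (p.rep j)) (by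
    intro h
    apply p.rep_nonzero
    funext j
    have hj := congrFun h j
    simpa using hj)

/-- A property of pairs `(X, Y)` of labeled `n`-point configurations in the plane holds for generic
`(X, Y)`: it holds off the zero locus of some nonzero polynomial in the homogeneous coordinates.
The set of configurations for which some choice of coordinates avoids the zero locus of `Δ`
is the union of the nonvanishing loci of the multihomogeneous components of `Δ`, a nonempty
Zariski open subset of the product of projective planes. -/
def HoldsGenerically {K : Type*} [Field K] (n : ℕ)
    (P : (Fin n → Plane K) → (Fin n → Plane K) → Prop) : Prop :=
  ∃ Δ : MvPolynomial ((Fin n × Fin 3) ⊕ (Fin n × Fin 3)) K, Δ ≠ 0 ∧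
    ∀ (u v : Fin n → Fin 3 → K) (hu : ∀ i, u i ≠ 0) (hv : ∀ i, v i ≠ 0),
      MvPolynomial.eval (Sum.elim (fun s => u s.1 s.2) (fun s => v s.1 s.2)) Δ ≠ 0 →
        P (fun i => Projectivization.mk K (u i) (hu i))
          (fun i => Projectivization.mk K (v i) (hv i))

/-- `a` and `b` are the centers of two flatland cameras (rank-2 projections from the plane to the
line) `A`, `B` with `A xᵢ ∼ B yᵢ` for all `i`, i.e. both images are defined and they are equal as
points of the projective line. -/
def IsCenterPair {K : Type*} [Field K] {n : ℕ} (X Y : Fin n → Plane K) (a b : Plane K) : Prop :=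
  ∃ A B : Matrix (Fin 2) (Fin 3) K, A.rank = 2 ∧ B.rank = 2 ∧
    A *ᵥ a.rep = 0 ∧ B *ᵥ b.rep = 0 ∧
    ∀ i, A *ᵥ (X i).rep ≠ 0 ∧ B *ᵥ (Y i).rep ≠ 0 ∧
      ∃ c : K, c ≠ 0 ∧ A *ᵥ (X i).rep = c • (B *ᵥ (Y i).rep)

/-- The linear space of `3 × 3` matrices `F` with `yᵢᵀ F xᵢ = 0` for all `i`. -/
noncomputable def matrixSpace {K : Type*} [Field K] {n : ℕ} (X Y : Fin n → Plane K) :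
    Submodule K (Matrix (Fin 3) (Fin 3) K) where
  carrier := {F | ∀ i, (Y i).rep ⬝ᵥ (F *ᵥ (X i).rep) = 0}
  add_mem' := by
    intro F G hF hG i
    rw [Matrix.add_mulVec, dotProduct_add, hF i, hG i, add_zero]
  zero_mem' := by
    intro i
    rw [Matrix.zero_mulVec, dotProduct_zero]
  smul_mem' := by
    intro c F hF i
    rw [Matrix.smul_mulVec, dotProduct_smul, hF i, smul_zero]

/-- The camera centers variety: all `(a, b)` for which there is `F ≠ 0` with `F a = 0`,
`Fᵀ b = 0` and `yᵢᵀ F xᵢ = 0` for all `i`. -/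
def centersVariety {K : Type*} [Field K] {n : ℕ} (X Y : Fin n → Plane K) :
    Set (Plane K × Plane K) :=
  {p | ∃ F ∈ matrixSpace X Y, F ≠ 0 ∧ F *ᵥ p.1.rep = 0 ∧ Fᵀ *ᵥ p.2.rep = 0}

/-- The camera centers variety of data over `K ⊆ ℂ`, as a set of complex points. -/
def complexCentersVariety {K : Type*} [Field K] [Algebra K ℂ] {n : ℕ} (X Y : Fin n → Plane K) :
    Set (Plane ℂ × Plane ℂ) :=
  centersVariety (fun i => toComplex (X i)) (fun i => toComplex (Y i))

/-- The vector of linear forms `F z`, in the indeterminate point `z = (z₀, z₁, z₂)`. -/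
noncomputable def linearForms {K : Type*} [Field K] (F : Matrix (Fin 3) (Fin 3) K) :
    Fin 3 → MvPolynomial (Fin 3) K :=
  (F.map MvPolynomial.C) *ᵥ MvPolynomial.X

/-- The three coordinates of the cross product `F₁ z × F₂ z`. -/
noncomputable def crossConics {K : Type*} [Field K] (F₁ F₂ : Matrix (Fin 3) (Fin 3) K) :
    Fin 3 → MvPolynomial (Fin 3) K :=
  crossProduct (linearForms F₁) (linearForms F₂)

/-- The three polynomials are equations of three distinct plane conics: nonzero quadratic
forms, no two of which are proportional. -/
def IsConicTriple {K : Type*} [Field K] (ω : Fin 3 → MvPolynomial (Fin 3) K) : Prop :=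
  (∀ i, (ω i).IsHomogeneous 2 ∧ ω i ≠ 0) ∧
    ∀ i j, i ≠ j → LinearIndependent K ![ω i, ω j]

/-- The common zeros of the polynomials `ω i` in the complex projective plane. -/
def complexIntersection {K : Type*} [Field K] [Algebra K ℂ]
    (ω : Fin 3 → MvPolynomial (Fin 3) K) : Set (Plane ℂ) :=
  ⋂ i, {p | MvPolynomial.aeval p.rep (ω i) = 0}

/-- The multidegree `d_{(i,j)}` of `V ⊆ ℙ² × ℙ²` equals `d` (for `V` of dimension `i + j`): `V` meets
`i` generic lines of the first plane and `j` generic lines of the second in exactly `d` points. -/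
def HasMultidegree (V : Set (Plane ℂ × Plane ℂ)) (i j d : ℕ) : Prop :=
  ∃ Δ : MvPolynomial ((Fin i × Fin 3) ⊕ (Fin j × Fin 3)) ℂ, Δ ≠ 0 ∧
    ∀ (l : Fin i → Fin 3 → ℂ) (m : Fin j → Fin 3 → ℂ),
      MvPolynomial.eval (Sum.elim (fun s => l s.1 s.2) (fun s => m s.1 s.2)) Δ ≠ 0 →
        {p ∈ V | (∀ k, l k ⬝ᵥ p.1.rep = 0) ∧ ∀ k, m k ⬝ᵥ p.2.rep = 0}.encard = d

end FlatlandCameras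

open FlatlandCameras

/-!
The center pairs of a configuration are among the pairs of a kernel point and a cokernel point of
nonzero matrices `F` with `yᵢᵀ F xᵢ = 0`. For seven generic correspondences these matrices form a
pencil spanned by some `F₁` and `F₂`, with `F₁` invertible and `F₁⁻¹ F₂` diagonalizable over `ℂ`
with distinct eigenvalues. Up to a change of coordinates on both sides, the pencil then consists of
diagonal matrices, its singular members are the three with one vanishing diagonal entry, and their
kernels and cokernels are the coordinate points. The conics `F₁ a × F₂ a` vanish together exactly
when `F₁ a` and `F₂ a` are linearly dependent, that is, when a member of the pencil kills `a`.

Cramer's rule makes `F₁` and `F₂` polynomial in the data, once two further correspondences complete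
the seven equations to a square system. The genericity condition is thus the nonvanishing of a
polynomial, namely the determinant of this system times a discriminant of the pencil. Both are
nonzero for a configuration whose equations force `F` to be diagonal.
-/

namespace FlatlandCameras

section Pencil

open Matrix

theorem eq_zero_and_eq_zero_of_mul_add_mul_eq_zero {R : Type*} [CommRing R] [IsDomain R]
    {a b c d s t : R} (hdet : a * d ≠ c * b) (h₁ : s * a + t * b = 0) (h₂ : s * c + t * d = 0) :
    s = 0 ∧ t = 0 := by
  have hdet' := sub_ne_zero.2 hdet
  have hs : s * (a * d - c * b) = 0 := by linear_combination d * h₁ - b * h₂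
  have ht : t * (a * d - c * b) = 0 := by linear_combination a * h₂ - c * h₁
  exact ⟨(mul_eq_zero.1 hs).resolve_right hdet', (mul_eq_zero.1 ht).resolve_right hdet'⟩

variable {k : Type*} [Field k] {m n : Type*}

theorem subsingleton_setOf_smul_add_smul_eq_zero {α β : n → k}
    (h : Pairwise fun i j => α i * β j ≠ α j * β i) {s t : k} (hst : s • α + t • β ≠ 0) :
    {i | (s • α + t • β) i = 0}.Subsingleton := by
  intro i hi j hj
  by_contra hij
  obtain ⟨rfl, rfl⟩ := eq_zero_and_eq_zero_of_mul_add_mul_eq_zero (h hij) hi hj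
  simp at hst

variable [Fintype m] [Fintype n]

/-- The pairs of a kernel point and a cokernel point of a nonzero member of a linear system of
matrices. -/
def kernelPairs (L : Submodule k (Matrix m n k)) : Set (ℙ k (n → k) × ℙ k (m → k)) :=
  {p | ∃ H ∈ L, H ≠ 0 ∧ H *ᵥ p.1.rep = 0 ∧ Hᵀ *ᵥ p.2.rep = 0}

theorem image_fst_kernelPairs (L : Submodule k (Matrix n n k)) :
    Prod.fst '' kernelPairs L = {a | ∃ H ∈ L, H ≠ 0 ∧ H *ᵥ a.rep = 0} := by
  classical
  ext a
  constructor
  · rintro ⟨p, ⟨H, hH, hH0, ha, -⟩, rfl⟩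
    exact ⟨H, hH, hH0, ha⟩
  · rintro ⟨H, hH, hH0, ha⟩
    have hdet : Hᵀ.det = 0 :=
      (det_transpose H).trans (exists_mulVec_eq_zero_iff.1 ⟨_, a.rep_nonzero, ha⟩)
    obtain ⟨w, hw0, hw⟩ := exists_mulVec_eq_zero_iff.2 hdet
    obtain ⟨c, hc⟩ := Projectivization.exists_smul_eq_mk_rep k w hw0
    exact ⟨(a, .mk k w hw0), ⟨H, hH, hH0, ha, by rw [← hc, mulVec_smul, hw, smul_zero]⟩, rfl⟩

theorem kernelPairs_map_transpose (L : Submodule k (Matrix m n k)) :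
    kernelPairs (L.map (transposeLinearEquiv m n k k).toLinearMap) =
      Prod.swap '' kernelPairs L := by
  rw [Set.image_swap_eq_preimage_swap]
  ext ⟨b, a⟩
  constructor
  · rintro ⟨_, ⟨H, hH, rfl⟩, hH0, hb, ha⟩
    exact ⟨H, hH, fun h => hH0 (by simp [h]), ha, hb⟩
  · rintro ⟨H, hH, hH0, ha, hb⟩
    exact ⟨Hᵀ, ⟨H, hH, rfl⟩, transpose_eq_zero.not.2 hH0, hb, ha⟩

theorem image_snd_kernelPairs_span_pair (F G : Matrix m n k) :
    Prod.snd '' kernelPairs (Submodule.span k {F, G}) =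
      Prod.fst '' kernelPairs (Submodule.span k {Fᵀ, Gᵀ}) := by
  have hspan : Submodule.span k {Fᵀ, Gᵀ} =
      (Submodule.span k {F, G}).map (transposeLinearEquiv m n k k).toLinearMap := by
    rw [Submodule.map_span, Set.image_pair]
    rfl
  rw [hspan, kernelPairs_map_transpose, Set.image_image]
  rfl

variable [DecidableEq n]

/-- The pencil spanned by `F` and `G` is equivalent to a pencil of diagonal matrices whose
diagonals `α` and `β` have pairwise distinct ratios `α i : β i`. -/
def IsSplitPencil (F G : Matrix n n k) : Prop :=
  ∃ (P Q : Matrix n n k) (α β : n → k), IsUnit P.det ∧ IsUnit Q.det ∧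
    F = P * diagonal α * Q ∧ G = P * diagonal β * Q ∧
    Pairwise fun i j => α i * β j ≠ α j * β i

theorem smul_add_smul_mul_diagonal_mul (P Q : Matrix n n k) (α β : n → k) (s t : k) :
    s • (P * diagonal α * Q) + t • (P * diagonal β * Q) = P * diagonal (s • α + t • β) * Q := by
  have : diagonal (s • α + t • β) = s • diagonal α + t • diagonal β := by
    rw [← diagonal_smul, ← diagonal_smul, diagonal_add]
    rfl
  simp [this, Matrix.mul_add, Matrix.add_mul]

theorem mul_diagonal_mul_injective {P Q : Matrix n n k} (hP : IsUnit P.det) (hQ : IsUnit Q.det) :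
    Function.Injective fun d : n → k => P * diagonal d * Q := by
  intro d e h
  have hPQ : P⁻¹ * (P * diagonal d * Q) * Q⁻¹ = P⁻¹ * (P * diagonal e * Q) * Q⁻¹ :=
    congrArg (P⁻¹ * · * Q⁻¹) h
  refine diagonal_injective ?_
  simpa only [Matrix.mul_assoc, mul_nonsing_inv _ hQ, Matrix.mul_one,
    nonsing_inv_mul_cancel_left _ _ hP] using hPQ

theorem mul_diagonal_mul_mulVec_eq_zero_iff {P : Matrix n n k} (hP : IsUnit P.det)
    (Q : Matrix n n k) (d x : n → k) :
    (P * diagonal d * Q) *ᵥ x = 0 ↔ ∀ i, d i * (Q *ᵥ x) i = 0 := by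
  have hinj := mulVec_injective_of_isUnit ((isUnit_iff_isUnit_det P).2 hP)
  rw [← mulVec_mulVec, ← mulVec_mulVec, ← mulVec_zero P, hinj.eq_iff, funext_iff]
  simp [mulVec_diagonal]

theorem exists_coordinatePoints {Q : Matrix n n k} (hQ : IsUnit Q.det) :
    ∃ p : n → ℙ k (n → k), Function.Injective p ∧
      ∀ a i, a = p i ↔ ∀ j, j ≠ i → (Q *ᵥ a.rep) j = 0 := by
  have hQe (i : n) : Q *ᵥ Q⁻¹ *ᵥ Pi.single i 1 = Pi.single i 1 := by
    rw [mulVec_mulVec, mul_nonsing_inv _ hQ, one_mulVec]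
  have hne (i : n) : Q⁻¹ *ᵥ Pi.single i 1 ≠ 0 := fun h => by
    simpa [h] using congrFun (hQe i) i
  have hp (a : ℙ k (n → k)) (i : n) :
      a = Projectivization.mk k _ (hne i) ↔ ∀ j, j ≠ i → (Q *ᵥ a.rep) j = 0 := by
    conv_lhs => rw [← a.mk_rep, Projectivization.mk_eq_mk_iff']
    constructor
    · rintro ⟨c, hc⟩ j hj
      simp only [← hc, mulVec_smul, hQe, Pi.smul_apply, Pi.single_eq_of_ne hj, smul_zero]
    · intro h
      have hsingle : (Q *ᵥ a.rep) i • (Pi.single i 1 : n → k) = Q *ᵥ a.rep := by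
        ext j
        obtain rfl | hj := eq_or_ne j i
        · simp
        · simp [hj, h j hj]
      exact ⟨_, by rw [← mulVec_smul, hsingle, mulVec_mulVec, nonsing_inv_mul _ hQ, one_mulVec]⟩
  refine ⟨_, fun i j hij => ?_, hp⟩
  by_contra hne'
  have hj := (hp _ j).1 hij i hne'
  obtain ⟨c, hc⟩ := Projectivization.exists_smul_eq_mk_rep k _ (hne i)
  simp only [← hc, mulVec_smul, hQe, Pi.smul_apply, Pi.single_eq_same, Units.smul_def,
    smul_eq_mul, mul_one, c.ne_zero] at hj

theorem exists_kernelPoints {P Q : Matrix n n k} (hP : IsUnit P.det) (hQ : IsUnit Q.det) :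
    ∃ p : n → ℙ k (n → k), Function.Injective p ∧ ∀ d : n → k, {i | d i = 0}.Subsingleton →
      ∀ a, (P * diagonal d * Q) *ᵥ a.rep = 0 ↔ ∃ i, d i = 0 ∧ a = p i := by
  obtain ⟨p, hinj, hp⟩ := exists_coordinatePoints hQ
  refine ⟨p, hinj, fun d hd a => ?_⟩
  simp only [mul_diagonal_mul_mulVec_eq_zero_iff hP, mul_eq_zero, hp]
  constructor
  · intro h
    obtain ⟨i, hi⟩ : ∃ i, (Q *ᵥ a.rep) i ≠ 0 :=
      Function.ne_iff.1 fun h0 => a.rep_nonzero <|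
        mulVec_injective_of_isUnit ((isUnit_iff_isUnit_det Q).2 hQ) (h0.trans (mulVec_zero Q).symm)
    have hdi : d i = 0 := (h i).resolve_right hi
    exact ⟨i, hdi, fun j hj => (h j).resolve_left fun hdj => hj (hd hdj hdi)⟩
  · rintro ⟨i, hdi, hi⟩ j
    obtain rfl | hj := eq_or_ne j i
    · exact .inl hdi
    · exact .inr (hi j hj)

namespace IsSplitPencil

variable {F G : Matrix n n k}

theorem transpose (h : IsSplitPencil F G) : IsSplitPencil Fᵀ Gᵀ := by
  obtain ⟨P, Q, α, β, hP, hQ, rfl, rfl, hαβ⟩ := h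
  exact ⟨Qᵀ, Pᵀ, α, β, isUnit_det_transpose Q hQ, isUnit_det_transpose P hP,
    by simp [Matrix.mul_assoc], by simp [Matrix.mul_assoc], hαβ⟩

theorem linearIndependent [Nontrivial n] (h : IsSplitPencil F G) :
    LinearIndependent k ![F, G] := by
  obtain ⟨P, Q, α, β, hP, hQ, rfl, rfl, hαβ⟩ := h
  refine LinearIndependent.pair_iff.2 fun s t hst => ?_
  have hd : s • α + t • β = 0 := mul_diagonal_mul_injective hP hQ <| by
    simpa [← smul_add_smul_mul_diagonal_mul] using hst
  obtain ⟨i, j, hij⟩ := exists_pair_ne n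
  exact eq_zero_and_eq_zero_of_mul_add_mul_eq_zero (hαβ hij) (congrFun hd i) (congrFun hd j)

theorem of_span_eq {F' G' : Matrix n n k} (h : IsSplitPencil F G)
    (hspan : Submodule.span k {F', G'} = Submodule.span k {F, G}) : IsSplitPencil F' G' := by
  obtain ⟨P, Q, α, β, hP, hQ, rfl, rfl, hαβ⟩ := h
  have hmem' : ∀ H ∈ ({F', G'} : Set (Matrix n n k)), ∃ d, H = P * diagonal d * Q := by
    intro H hH
    obtain ⟨s, t, rfl⟩ := Submodule.mem_span_pair.1 (hspan ▸ Submodule.subset_span hH)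
    exact ⟨_, smul_add_smul_mul_diagonal_mul P Q α β s t⟩
  obtain ⟨α', rfl⟩ := hmem' F' (by simp)
  obtain ⟨β', rfl⟩ := hmem' G' (by simp)
  have hmem : ∀ d, P * diagonal d * Q ∈ Submodule.span k {P * diagonal α * Q, P * diagonal β * Q} →
      ∃ s t : k, d = s • α' + t • β' := by
    intro d hd
    obtain ⟨s, t, hst⟩ := Submodule.mem_span_pair.1 (hspan ▸ hd)
    exact ⟨s, t, mul_diagonal_mul_injective hP hQ
      (hst.symm.trans (smul_add_smul_mul_diagonal_mul P Q α' β' s t))⟩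
  obtain ⟨x, y, rfl⟩ := hmem α (Submodule.subset_span (by simp))
  obtain ⟨z, w, rfl⟩ := hmem β (Submodule.subset_span (by simp))
  refine ⟨P, Q, α', β', hP, hQ, rfl, rfl, fun i j hij heq => hαβ hij ?_⟩
  simp only [Pi.add_apply, Pi.smul_apply, smul_eq_mul]
  linear_combination (x * w - y * z) * heq

theorem exists_kernelPairs_eq_range [Nontrivial n] (h : IsSplitPencil F G) :
    ∃ p q : n → ℙ k (n → k), Function.Injective p ∧ Function.Injective q ∧
      kernelPairs (Submodule.span k {F, G}) = Set.range fun i => (p i, q i) := by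
  obtain ⟨P, Q, α, β, hP, hQ, rfl, rfl, hαβ⟩ := h
  obtain ⟨p, hp, hker⟩ := exists_kernelPoints hP hQ
  obtain ⟨q, hq, hcoker⟩ :=
    exists_kernelPoints (isUnit_det_transpose Q hQ) (isUnit_det_transpose P hP)
  have htranspose (d : n → k) : (P * diagonal d * Q)ᵀ = Qᵀ * diagonal d * Pᵀ := by
    simp [Matrix.mul_assoc]
  refine ⟨p, q, hp, hq, Set.ext fun ⟨a, b⟩ => ⟨?_, ?_⟩⟩
  · rintro ⟨H, hH, hH0, ha, hb⟩
    obtain ⟨s, t, rfl⟩ := Submodule.mem_span_pair.1 hH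
    rw [smul_add_smul_mul_diagonal_mul] at hH0 ha hb
    have hd := subsingleton_setOf_smul_add_smul_eq_zero hαβ (s := s) (t := t)
      fun h0 => hH0 (by simp [h0])
    obtain ⟨i, hi, rfl⟩ := (hker _ hd a).1 ha
    obtain ⟨j, hj, rfl⟩ := (hcoker _ hd b).1 (htranspose _ ▸ hb)
    exact ⟨i, by rw [hd hi hj]⟩
  · rintro ⟨i, hi⟩
    obtain ⟨rfl, rfl⟩ := Prod.mk.inj hi
    -- the singular member `βᵢ F - αᵢ G` of the pencil
    have hd0 : β i • α + (-α i) • β ≠ 0 := by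
      obtain ⟨j, hj⟩ := exists_ne i
      refine fun h0 => hαβ hj ?_
      have h0j : β i * α j + -α i * β j = 0 := congrFun h0 j
      linear_combination h0j
    have hd := subsingleton_setOf_smul_add_smul_eq_zero hαβ hd0
    have hdi : (β i • α + (-α i) • β) i = 0 := by
      simp only [Pi.add_apply, Pi.smul_apply, smul_eq_mul]
      ring
    refine ⟨_, Submodule.mem_span_pair.2 ⟨β i, -α i, smul_add_smul_mul_diagonal_mul ..⟩,
      fun h0 => hd0 (mul_diagonal_mul_injective hP hQ (by simpa using h0)),
      (hker _ hd _).2 ⟨i, hdi, rfl⟩, ?_⟩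
    rw [htranspose]
    exact (hcoker _ hd _).2 ⟨i, hdi, rfl⟩

variable [Nontrivial n]

theorem encard_kernelPairs (h : IsSplitPencil F G) :
    (kernelPairs (Submodule.span k {F, G})).encard = Fintype.card n := by
  obtain ⟨p, q, hp, -, hpq⟩ := h.exists_kernelPairs_eq_range
  have hinj : Function.Injective fun i => (p i, q i) := fun i j hij => hp (Prod.mk.inj hij).1
  rw [hpq, ← Set.image_univ, hinj.encard_image, Set.encard_univ, ENat.card_eq_coe_fintype_card]

theorem injOn_fst_kernelPairs (h : IsSplitPencil F G) :
    Set.InjOn Prod.fst (kernelPairs (Submodule.span k {F, G})) := by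
  obtain ⟨p, q, hp, -, hpq⟩ := h.exists_kernelPairs_eq_range
  rw [hpq]
  rintro _ ⟨i, rfl⟩ _ ⟨j, rfl⟩ hij
  obtain rfl := hp hij
  rfl

theorem injOn_snd_kernelPairs (h : IsSplitPencil F G) :
    Set.InjOn Prod.snd (kernelPairs (Submodule.span k {F, G})) := by
  obtain ⟨p, q, -, hq, hpq⟩ := h.exists_kernelPairs_eq_range
  rw [hpq]
  rintro _ ⟨i, rfl⟩ _ ⟨j, rfl⟩ hij
  obtain rfl := hq hij
  rfl

end IsSplitPencil

end Pencil

section CrossProduct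

open Matrix

theorem mulVec_dotProduct_crossProduct_mulVec {R : Type*} [CommRing R]
    (P : Matrix (Fin 3) (Fin 3) R) (x y z : Fin 3 → R) :
    P *ᵥ x ⬝ᵥ (P *ᵥ y) ⨯₃ (P *ᵥ z) = P.det * (x ⬝ᵥ y ⨯₃ z) := by
  have hrows : of ![P *ᵥ x, P *ᵥ y, P *ᵥ z] = of ![x, y, z] * Pᵀ := by
    ext i j
    fin_cases i <;> simp [mul_apply, mulVec, dotProduct, mul_comm]
  calc P *ᵥ x ⬝ᵥ (P *ᵥ y) ⨯₃ (P *ᵥ z) = (of ![P *ᵥ x, P *ᵥ y, P *ᵥ z]).det :=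
        triple_product_eq_det ..
    _ = P.det * (of ![x, y, z]).det := by rw [hrows, det_mul, det_transpose, mul_comm]
    _ = P.det * (x ⬝ᵥ y ⨯₃ z) := congrArg (P.det * ·) (triple_product_eq_det x y z).symm

variable {k : Type*} [Field k] {F G : Matrix (Fin 3) (Fin 3) k}

theorem crossProduct_mulVec_eq_zero_iff (hFG : LinearIndependent k ![F, G]) (z : Fin 3 → k) :
    (F *ᵥ z) ⨯₃ (G *ᵥ z) = 0 ↔ ∃ H ∈ Submodule.span k {F, G}, H ≠ 0 ∧ H *ᵥ z = 0 := by
  have hne (s t : k) : s • F + t • G ≠ 0 ↔ ¬(s = 0 ∧ t = 0) :=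
    not_congr ⟨LinearIndependent.pair_iff.1 hFG s t, fun ⟨hs, ht⟩ => by simp [hs, ht]⟩
  rw [← not_iff_not, ← ne_eq, crossProduct_ne_zero_iff_linearIndependent,
    LinearIndependent.pair_iff]
  simp only [Submodule.mem_span_pair, exists_exists_exists_and_eq, hne, add_mulVec, smul_mulVec]
  push Not
  grind

theorem IsSplitPencil.image_fst_kernelPairs_eq (h : IsSplitPencil F G) :
    Prod.fst '' kernelPairs (Submodule.span k {F, G}) =
      {a | (F *ᵥ a.rep) ⨯₃ (G *ᵥ a.rep) = 0} := by
  rw [image_fst_kernelPairs]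
  exact Set.ext fun a => (crossProduct_mulVec_eq_zero_iff h.linearIndependent _).symm

theorem IsSplitPencil.image_snd_kernelPairs_eq (h : IsSplitPencil F G) :
    Prod.snd '' kernelPairs (Submodule.span k {F, G}) =
      {b | (Fᵀ *ᵥ b.rep) ⨯₃ (Gᵀ *ᵥ b.rep) = 0} := by
  rw [image_snd_kernelPairs_span_pair, h.transpose.image_fst_kernelPairs_eq]

theorem IsSplitPencil.eq_zero_of_dotProduct_crossProduct (h : IsSplitPencil F G) {c : Fin 3 → k}
    (hc : ∀ z, c ⬝ᵥ (F *ᵥ z) ⨯₃ (G *ᵥ z) = 0) : c = 0 := by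
  obtain ⟨P, Q, α, β, hP, hQ, rfl, rfl, hαβ⟩ := h
  obtain ⟨d, rfl⟩ : ∃ d, P *ᵥ d = c :=
    ⟨P⁻¹ *ᵥ c, by rw [mulVec_mulVec, mul_nonsing_inv _ hP, one_mulVec]⟩
  have hdiagonal (w : Fin 3 → k) : d ⬝ᵥ (diagonal α *ᵥ w) ⨯₃ (diagonal β *ᵥ w) = 0 := by
    have hQw : Q *ᵥ Q⁻¹ *ᵥ w = w := by rw [mulVec_mulVec, mul_nonsing_inv _ hQ, one_mulVec]
    have hcw := hc (Q⁻¹ *ᵥ w)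
    simp only [← mulVec_mulVec, hQw, mulVec_dotProduct_crossProduct_mulVec] at hcw
    exact (mul_eq_zero.1 hcw).resolve_left hP.ne_zero
  have hexpand (w : Fin 3 → k) : (α 1 * β 2 - α 2 * β 1) * (d 0 * (w 1 * w 2)) +
      (α 2 * β 0 - α 0 * β 2) * (d 1 * (w 2 * w 0)) +
      (α 0 * β 1 - α 1 * β 0) * (d 2 * (w 0 * w 1)) = 0 := by
    rw [← hdiagonal w, cross_apply]
    simp only [mulVec_diagonal, dotProduct, Fin.sum_univ_three, cons_val]
    ring
  have hminor {i j : Fin 3} (hij : i ≠ j) : α i * β j - α j * β i ≠ 0 := sub_ne_zero.2 (hαβ hij)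
  have hd₀ : d 0 = 0 := by simpa [hminor (show (1 : Fin 3) ≠ 2 by decide)] using hexpand ![0, 1, 1]
  have hd₁ : d 1 = 0 := by simpa [hminor (show (2 : Fin 3) ≠ 0 by decide)] using hexpand ![1, 0, 1]
  have hd₂ : d 2 = 0 := by simpa [hminor (show (0 : Fin 3) ≠ 1 by decide)] using hexpand ![1, 1, 0]
  have hd : d = 0 := by
    ext i
    fin_cases i <;> assumption
  rw [hd, mulVec_zero]

end CrossProduct

section Discriminant

open Matrix Polynomial

variable {n : Type*} [Fintype n] [DecidableEq n]

theorem exists_mul_eq_mul_diagonal {k : Type*} [Field k] {S : Matrix n n k}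
    (hsplit : S.charpoly.Splits) (hsep : S.charpoly.Separable) :
    ∃ (V : Matrix n n k) (μ : n → k), IsUnit V.det ∧ Function.Injective μ ∧
      S * V = V * diagonal μ := by
  classical
  have hcard : Fintype.card n = Fintype.card S.charpoly.roots.toFinset := by
    rw [Fintype.card_coe, Multiset.toFinset_card_of_nodup (nodup_roots hsep),
      ← hsplit.natDegree_eq_card_roots, charpoly_natDegree_eq_dim]
  let μ := Fintype.equivOfCardEq hcard
  have heigen (i : n) : ∃ v : n → k, v ≠ 0 ∧ S *ᵥ v = (μ i : k) • v := by
    have hroot : S.charpoly.eval (μ i : k) = 0 :=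
      isRoot_of_mem_roots (Multiset.mem_toFinset.1 (μ i).2)
    rw [eval_charpoly] at hroot
    obtain ⟨v, hv0, hv⟩ := exists_mulVec_eq_zero_iff.2 hroot
    rw [sub_mulVec, sub_eq_zero] at hv
    exact ⟨v, hv0, hv.symm.trans (by simp [scalar_apply, ← smul_one_eq_diagonal, smul_mulVec])⟩
  choose v hv0 hv using heigen
  have hμ : Function.Injective fun i => (μ i : k) := Subtype.val_injective.comp μ.injective
  have hli : LinearIndependent k v := by
    refine Module.End.eigenvectors_linearIndependent' (toLin' S) _ hμ v fun i => ?_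
    rw [Module.End.hasEigenvector_iff, Module.End.mem_eigenspace_iff]
    exact ⟨by simpa using hv i, hv0 i⟩
  refine ⟨(of v)ᵀ, fun i => μ i, (isUnit_iff_isUnit_det _).1
    (linearIndependent_cols_iff_isUnit.1 hli), hμ, ?_⟩
  ext i j
  rw [mul_diagonal, mul_comm]
  exact congrFun (hv j) i

/-- The discriminant of the pencil spanned by `F` and `G`: over a field it is nonzero exactly when
`F` is invertible and `F⁻¹ * G` has no multiple eigenvalue. The adjugate stands in for the inverse
to make it a polynomial in the entries of `F` and `G`. -/
noncomputable def pencilDiscr {R : Type*} [CommRing R] (F G : Matrix n n R) : R :=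
  F.det * resultant (F.adjugate * G).charpoly (derivative (F.adjugate * G).charpoly)
    (Fintype.card n) (Fintype.card n - 1)

theorem map_pencilDiscr {R S : Type*} [CommRing R] [CommRing S] (φ : R →+* S)
    (F G : Matrix n n R) : φ (pencilDiscr F G) = pencilDiscr (F.map φ) (G.map φ) := by
  have hadj : (F.map φ).adjugate = F.adjugate.map φ := (RingHom.map_adjugate φ F).symm
  rw [pencilDiscr, pencilDiscr, map_mul, RingHom.map_det, RingHom.mapMatrix_apply, hadj,
    ← Matrix.map_mul, charpoly_map, derivative_map, resultant_map_map]

variable {k : Type*} [Field k]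

theorem pencilDiscr_ne_zero_iff {F G : Matrix n n k} :
    pencilDiscr F G ≠ 0 ↔ F.det ≠ 0 ∧ (F.adjugate * G).charpoly.Separable := by
  rw [pencilDiscr, mul_ne_zero_iff, and_congr_right_iff]
  intro _
  set χ := (F.adjugate * G).charpoly
  have hmonic : χ.Monic := charpoly_monic _
  have hdeg : χ.natDegree = Fintype.card n := charpoly_natDegree_eq_dim _
  obtain ⟨d, hd⟩ := Nat.exists_eq_add_of_le (natDegree_derivative_le χ)
  rw [← hdeg, hd, resultant_add_right_deg _ _ _ _ _ le_rfl, ← isUnit_iff_ne_zero, IsUnit.mul_iff,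
    isUnit_resultant_iff_isCoprime hmonic, Polynomial.Separable, hmonic.coeff_natDegree]
  simp

theorem isSplitPencil_of_pencilDiscr_ne_zero [IsAlgClosed k] {F G : Matrix n n k}
    (h : pencilDiscr F G ≠ 0) : IsSplitPencil F G := by
  obtain ⟨hF, hsep⟩ := pencilDiscr_ne_zero_iff.1 h
  obtain ⟨V, μ, hV, hμ, hSV⟩ := exists_mul_eq_mul_diagonal (IsAlgClosed.splits _) hsep
  have hFGV : F.det • (G * V) = F * V * diagonal μ := by
    rw [Matrix.mul_assoc, ← hSV, ← Matrix.mul_assoc, ← Matrix.mul_assoc, mul_adjugate,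
      Matrix.smul_mul, Matrix.one_mul, Matrix.smul_mul]
  refine ⟨F * V, V⁻¹, 1, F.det⁻¹ • μ, by simpa [det_mul] using ⟨hF, hV.ne_zero⟩,
    isUnit_nonsing_inv_det V hV, ?_, ?_, fun i j hij => ?_⟩
  · rw [diagonal_one', Matrix.mul_one, mul_nonsing_inv_cancel_right _ _ hV]
  · rw [diagonal_smul, Matrix.mul_smul, ← hFGV, inv_smul_smul₀ hF,
      mul_nonsing_inv_cancel_right _ _ hV]
  · simpa [hF] using hμ.ne hij.symm

end Discriminant

section Cramer

open Matrix

variable {R : Type*} [CommRing R]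

theorem mem_span_adjugate_col_image_iff {n : Type*} [Fintype n] [DecidableEq n]
    {A : Matrix n n R} (hA : IsUnit A.det) (s : Set n) (x : n → R) :
    x ∈ Submodule.span R (A.adjugate.col '' s) ↔ ∀ i ∉ s, (A *ᵥ x) i = 0 := by
  constructor
  · intro hx i hi
    induction hx using Submodule.span_induction with
    | mem x hx =>
      obtain ⟨j, hj, rfl⟩ := hx
      have hij : i ≠ j := fun h => hi (h ▸ hj)
      exact (congrFun (congrFun A.mul_adjugate i) j).trans (by simp [hij])
    | zero => simp
    | add x y _ _ hx hy => simp [mulVec_add, hx, hy]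
    | smul c x _ hx => simp [mulVec_smul, hx]
  · intro hx
    have hsum : A.det • x = ∑ i, (A *ᵥ x) i • A.adjugate.col i := by
      rw [← one_mulVec x, ← smul_mulVec, ← adjugate_mul, ← mulVec_mulVec, one_mulVec]
      ext j
      simp [mulVec, dotProduct, mul_comm]
    have hmem : A.det • x ∈ Submodule.span R (A.adjugate.col '' s) := by
      rw [hsum]
      refine Submodule.sum_mem _ fun i _ => ?_
      by_cases hi : i ∈ s
      · exact Submodule.smul_mem _ _ (Submodule.subset_span (Set.mem_image_of_mem _ hi))
      · simp [hx i hi]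
    exact (Submodule.smul_mem_iff_of_isUnit _ hA).1 hmem

variable {m n ι κ : Type*}

/-- The coefficient matrix of the linear forms `F ↦ vᵣᵀ F uᵣ` in the entries of a matrix `F`, where
`F` is vectorized by `Matrix.vec` and `e` numbers the entries by the index set of the forms. -/
def correspondenceMatrix (e : n × m ≃ ι ⊕ κ) (u : ι ⊕ κ → n → R) (v : ι ⊕ κ → m → R) :
    Matrix (n × m) (n × m) R :=
  of fun r => vec (vecMulVec (v (e r)) (u (e r)))

theorem map_correspondenceMatrix {S : Type*} [CommRing S] (φ : R →+* S) (e : n × m ≃ ι ⊕ κ)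
    (u : ι ⊕ κ → n → R) (v : ι ⊕ κ → m → R) :
    (correspondenceMatrix e u v).map φ =
      correspondenceMatrix e (fun r => φ ∘ u r) (fun r => φ ∘ v r) := by
  ext r s
  simp [correspondenceMatrix, vec, vecMulVec_apply]

variable [Fintype m] [Fintype n]

theorem correspondenceMatrix_mulVec_vec (e : n × m ≃ ι ⊕ κ) (u : ι ⊕ κ → n → R)
    (v : ι ⊕ κ → m → R) (F : Matrix m n R) (r : n × m) :
    (correspondenceMatrix e u v *ᵥ vec F) r = v (e r) ⬝ᵥ F *ᵥ u (e r) := by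
  simp only [correspondenceMatrix, mulVec, of_apply, dotProduct, vec, Fintype.sum_prod_type,
    vecMulVec_apply, Finset.mul_sum]
  rw [Finset.sum_comm]
  exact Finset.sum_congr rfl fun i _ => Finset.sum_congr rfl fun j _ => by ring

variable [DecidableEq m] [DecidableEq n]

/-- The solution, up to the factor `det`, of the square linear system `vᵣᵀ F uᵣ = 0` for `r ≠ j`,
`vⱼᵀ F uⱼ = 1` given by Cramer's rule. The equations indexed by `κ` are auxiliary: they complete
those indexed by `ι` to a square system. -/
def cramerSolution (e : n × m ≃ ι ⊕ κ) (u : ι ⊕ κ → n → R) (v : ι ⊕ κ → m → R) (j : κ) :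
    Matrix m n R :=
  of fun a b => (correspondenceMatrix e u v).adjugate (b, a) (e.symm (Sum.inr j))

theorem dotProduct_cramerSolution_mulVec [DecidableEq (ι ⊕ κ)] (e : n × m ≃ ι ⊕ κ)
    (u : ι ⊕ κ → n → R) (v : ι ⊕ κ → m → R) (j : κ) (r : ι ⊕ κ) :
    v r ⬝ᵥ cramerSolution e u v j *ᵥ u r =
      if r = Sum.inr j then (correspondenceMatrix e u v).det else 0 := by
  obtain ⟨r, rfl⟩ := e.surjective r
  rw [← correspondenceMatrix_mulVec_vec]
  refine (congrFun (congrFun (mul_adjugate _) r) (e.symm (Sum.inr j))).trans ?_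
  simp [Matrix.one_apply, Equiv.eq_symm_apply]

theorem mem_span_range_cramerSolution_iff {e : n × m ≃ ι ⊕ κ} {u : ι ⊕ κ → n → R}
    {v : ι ⊕ κ → m → R} (hdet : IsUnit (correspondenceMatrix e u v).det) {F : Matrix m n R} :
    F ∈ Submodule.span R (Set.range (cramerSolution e u v)) ↔
      ∀ i, v (Sum.inl i) ⬝ᵥ F *ᵥ u (Sum.inl i) = 0 := by
  let vecEquiv : Matrix m n R ≃ₗ[R] (n × m → R) :=
    (transposeLinearEquiv m n R R).trans (LinearEquiv.curry R R n m).symm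
  have himage : vecEquiv '' Set.range (cramerSolution e u v) =
      (correspondenceMatrix e u v).adjugate.col '' (e ⁻¹' Set.range Sum.inr) := by
    rw [← e.image_symm_eq_preimage, ← Set.range_comp, ← Set.range_comp, ← Set.range_comp]
    rfl
  calc F ∈ Submodule.span R (Set.range (cramerSolution e u v))
      ↔ vec F ∈ Submodule.span R
          ((correspondenceMatrix e u v).adjugate.col '' (e ⁻¹' Set.range Sum.inr)) := by
        rw [← himage]
        exact (Submodule.apply_mem_span_image_iff_mem_span (f := vecEquiv.toLinearMap)
          vecEquiv.injective).symm
    _ ↔ ∀ r ∉ e ⁻¹' Set.range Sum.inr, v (e r) ⬝ᵥ F *ᵥ u (e r) = 0 := by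
        simp only [mem_span_adjugate_col_image_iff hdet, correspondenceMatrix_mulVec_vec]
    _ ↔ ∀ i, v (Sum.inl i) ⬝ᵥ F *ᵥ u (Sum.inl i) = 0 := by
        rw [← e.symm.forall_congr_right]
        simp

theorem map_cramerSolution {S : Type*} [CommRing S] (φ : R →+* S) (e : n × m ≃ ι ⊕ κ)
    (u : ι ⊕ κ → n → R) (v : ι ⊕ κ → m → R) (j : κ) :
    (cramerSolution e u v j).map φ =
      cramerSolution e (fun r => φ ∘ u r) (fun r => φ ∘ v r) j := by
  have hadj := RingHom.map_adjugate φ (correspondenceMatrix e u v)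
  rw [RingHom.mapMatrix_apply, RingHom.mapMatrix_apply, map_correspondenceMatrix] at hadj
  ext a b
  exact congrFun (congrFun hadj _) _

end Cramer

section SevenCorrespondences

open Matrix

variable {R : Type*} [CommRing R]

/-- The nine entries of a `3 × 3` matrix, numbered by seven correspondences and two auxiliary
equations. -/
def entryEquiv : Fin 3 × Fin 3 ≃ Fin 7 ⊕ Fin 2 :=
  (finProdFinEquiv (m := 3) (n := 3)).trans (finSumFinEquiv (m := 7) (n := 2)).symm

/-- Seven points followed by two fixed ones. Used for both views, they complete the linear system
`vᵢᵀ F uᵢ = 0` to a square one that is invertible for generic data. -/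
def withAuxiliaryPoints (u : Fin 7 → Fin 3 → R) : Fin 7 ⊕ Fin 2 → Fin 3 → R :=
  Sum.elim u ![![1, 0, 0], ![1, 1, 0]]

/-- The determinant of the linear system of seven correspondences, completed by the two auxiliary
ones. -/
def systemDet (u v : Fin 7 → Fin 3 → R) : R :=
  (correspondenceMatrix entryEquiv (withAuxiliaryPoints u) (withAuxiliaryPoints v)).det

/-- The pair of solutions of the system of seven correspondences given by Cramer's rule. -/
def systemSolution (u v : Fin 7 → Fin 3 → R) : Fin 2 → Matrix (Fin 3) (Fin 3) R :=
  cramerSolution entryEquiv (withAuxiliaryPoints u) (withAuxiliaryPoints v)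

/-- The polynomial in the coordinates of the seven correspondences whose nonvanishing makes the
configuration generic. -/
noncomputable def systemDiscr (u v : Fin 7 → Fin 3 → R) : R :=
  systemDet u v * pencilDiscr (systemSolution u v 0) (systemSolution u v 1)

theorem map_withAuxiliaryPoints {S : Type*} [CommRing S] (φ : R →+* S) (u : Fin 7 → Fin 3 → R) :
    (fun r => φ ∘ withAuxiliaryPoints u r) = withAuxiliaryPoints fun i => φ ∘ u i := by
  ext (i | j) l
  · rfl
  · fin_cases j <;> fin_cases l <;> simp [withAuxiliaryPoints]

theorem map_systemSolution {S : Type*} [CommRing S] (φ : R →+* S) (u v : Fin 7 → Fin 3 → R)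
    (j : Fin 2) :
    (systemSolution u v j).map φ = systemSolution (fun i => φ ∘ u i) (fun i => φ ∘ v i) j := by
  simp only [systemSolution, map_cramerSolution, map_withAuxiliaryPoints]

theorem map_systemDiscr {S : Type*} [CommRing S] (φ : R →+* S) (u v : Fin 7 → Fin 3 → R) :
    φ (systemDiscr u v) = systemDiscr (fun i => φ ∘ u i) (fun i => φ ∘ v i) := by
  simp only [systemDiscr, systemDet, map_mul, RingHom.map_det, RingHom.mapMatrix_apply,
    map_correspondenceMatrix, map_withAuxiliaryPoints, map_pencilDiscr, map_systemSolution]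

theorem dotProduct_systemSolution_mulVec (u v : Fin 7 → Fin 3 → R) (j : Fin 2) (i : Fin 7) :
    v i ⬝ᵥ systemSolution u v j *ᵥ u i = 0 :=
  (dotProduct_cramerSolution_mulVec entryEquiv (withAuxiliaryPoints u) (withAuxiliaryPoints v) j
    (Sum.inl i)).trans (if_neg Sum.inl_ne_inr)

theorem dotProduct_systemSolution_mulVec_auxiliary (u v : Fin 7 → Fin 3 → R) (i j : Fin 2) :
    withAuxiliaryPoints v (Sum.inr i) ⬝ᵥ
        systemSolution u v j *ᵥ withAuxiliaryPoints u (Sum.inr i) =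
      if i = j then systemDet u v else 0 :=
  (dotProduct_cramerSolution_mulVec entryEquiv _ _ j (Sum.inr i)).trans (by simp [systemDet])

theorem mem_span_systemSolution_iff {u v : Fin 7 → Fin 3 → R} (hdet : IsUnit (systemDet u v))
    {F : Matrix (Fin 3) (Fin 3) R} :
    F ∈ Submodule.span R {systemSolution u v 0, systemSolution u v 1} ↔
      ∀ i, v i ⬝ᵥ F *ᵥ u i = 0 := by
  have hrange : Set.range (systemSolution u v) = {systemSolution u v 0, systemSolution u v 1} := by
    ext F
    simp [Fin.exists_fin_two, eq_comm]
  rw [← hrange]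
  exact mem_span_range_cramerSolution_iff hdet

/-- The first points of a sample configuration of seven correspondences with a split pencil: the
first six correspondences annihilate the off-diagonal entries of a matrix. -/
def sampleLeft (R : Type*) [CommRing R] : Fin 7 → Fin 3 → R :=
  ![![1, 0, 0], ![1, 0, 0], ![0, 1, 0], ![0, 1, 0], ![0, 0, 1], ![0, 0, 1], ![1, 1, 1]]

/-- The second points of the sample configuration of seven correspondences. -/
def sampleRight (R : Type*) [CommRing R] : Fin 7 → Fin 3 → R :=
  ![![0, 1, 0], ![0, 0, 1], ![1, 0, 0], ![0, 0, 1], ![1, 0, 0], ![0, 1, 0], ![1, 2, 1]]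

theorem eq_diagonal_of_sample_correspondences {F : Matrix (Fin 3) (Fin 3) R} (t : Fin 2 → R)
    (hF : ∀ i, sampleRight R i ⬝ᵥ F *ᵥ sampleLeft R i = 0)
    (haux : ∀ i, withAuxiliaryPoints (sampleRight R) (Sum.inr i) ⬝ᵥ
      F *ᵥ withAuxiliaryPoints (sampleLeft R) (Sum.inr i) = t i) :
    F = diagonal ![t 0, t 1 - t 0, t 0 - 2 * t 1] := by
  obtain ⟨h10, h20, h01, h21, h02, h12, hsum⟩ :
      F 1 0 = 0 ∧ F 2 0 = 0 ∧ F 0 1 = 0 ∧ F 2 1 = 0 ∧ F 0 2 = 0 ∧ F 1 2 = 0 ∧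
        F 0 0 + F 0 1 + F 0 2 + 2 * (F 1 0 + F 1 1 + F 1 2) + (F 2 0 + F 2 1 + F 2 2) = 0 := by
    simpa [sampleLeft, sampleRight, Fin.forall_fin_succ, mulVec, dotProduct, Fin.sum_univ_three]
      using hF
  have h00 : F 0 0 = t 0 := by
    simpa [withAuxiliaryPoints, mulVec, dotProduct, Fin.sum_univ_three] using haux 0
  have h11 : F 0 0 + F 0 1 + (F 1 0 + F 1 1) = t 1 := by
    simpa [withAuxiliaryPoints, mulVec, dotProduct, Fin.sum_univ_three] using haux 1
  ext i j
  fin_cases i <;> fin_cases j <;> simp [*] <;> grind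

theorem systemDet_sample_ne_zero {k : Type*} [Field k] :
    systemDet (sampleLeft k) (sampleRight k) ≠ 0 := by
  intro hdet
  obtain ⟨w, hw, hMw⟩ := exists_mulVec_eq_zero_iff.2 hdet
  let F : Matrix (Fin 3) (Fin 3) k := of fun a b => w (b, a)
  have hF : ∀ r, withAuxiliaryPoints (sampleRight k) r ⬝ᵥ
      F *ᵥ withAuxiliaryPoints (sampleLeft k) r = 0 := fun r => by
    obtain ⟨r, rfl⟩ := entryEquiv.surjective r
    rw [← correspondenceMatrix_mulVec_vec]
    exact congrFun hMw r
  have hF0 : F = 0 := by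
    rw [eq_diagonal_of_sample_correspondences 0 (fun i => hF (Sum.inl i)) fun i => hF (Sum.inr i)]
    ext i j
    fin_cases i <;> fin_cases j <;> simp
  exact hw (funext fun s => congrFun (congrFun hF0 s.2) s.1)

theorem systemSolution_sample (j : Fin 2) :
    systemSolution (sampleLeft R) (sampleRight R) j =
      systemDet (sampleLeft R) (sampleRight R) • diagonal (![![1, -1, 1], ![0, 1, -2]] j) := by
  rw [eq_diagonal_of_sample_correspondences _ (fun i => dotProduct_systemSolution_mulVec _ _ j i)
    fun i => dotProduct_systemSolution_mulVec_auxiliary _ _ i j, ← diagonal_smul]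
  congr 1
  ext i
  fin_cases i <;> fin_cases j <;> simp [mul_comm]

theorem exists_systemDiscr_ne_zero (k : Type*) [Field k] [CharZero k] :
    ∃ u v : Fin 7 → Fin 3 → k, systemDiscr u v ≠ 0 := by
  refine ⟨sampleLeft k, sampleRight k, mul_ne_zero systemDet_sample_ne_zero ?_⟩
  have hdet := systemDet_sample_ne_zero (k := k)
  rw [pencilDiscr_ne_zero_iff, systemSolution_sample, systemSolution_sample]
  set D := systemDet (sampleLeft k) (sampleRight k)
  have hadj : (diagonal ![(1 : k), -1, 1]).adjugate = diagonal ![-1, 1, -1] := by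
    rw [adjugate_diagonal]
    congr 1
    ext i
    fin_cases i
    · simp [show Finset.univ.erase (0 : Fin 3) = {1, 2} from rfl]
    · simp [show Finset.univ.erase (1 : Fin 3) = {0, 2} from rfl]
    · simp [show Finset.univ.erase (2 : Fin 3) = {0, 1} from rfl]
  have hprod : (D • diagonal ![(1 : k), -1, 1]).adjugate * D • diagonal ![0, 1, -2] =
      diagonal (D ^ 3 • ![0, 1, 2]) := by
    rw [adjugate_smul, hadj, smul_mul_smul_comm, diagonal_mul_diagonal, ← diagonal_smul]
    congr 1
    ext i
    fin_cases i <;> simp [pow_succ]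
  refine ⟨by simp [hdet, Fin.prod_univ_three], ?_⟩
  simp only [cons_val_zero, cons_val_one]
  rw [hprod, charpoly_diagonal, Polynomial.separable_prod_X_sub_C_iff]
  have hinj : Function.Injective ![(0 : k), 1, 2] := by
    intro i j
    fin_cases i <;> fin_cases j <;> simp
  exact (smul_right_injective k (pow_ne_zero 3 hdet)).comp hinj

end SevenCorrespondences
section BaseChange

open Matrix

variable {K A : Type*} [Field K] [CommRing A] [Algebra K A] {m n : Type*}

theorem mem_span_range_map_linearMap [Finite m] [Finite n] (F : Matrix m n A) :
    F ∈ Submodule.span A (Set.range fun f : A →ₗ[K] K => (F.map f).map (algebraMap K A)) := by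
  have := Fintype.ofFinite m
  have := Fintype.ofFinite n
  classical
  let b := Module.Basis.ofVectorSpace K A
  let T := Finset.univ.biUnion fun p : m × n => (b.repr (F p.1 p.2)).support
  have hsum : F = ∑ s ∈ T, b s • (F.map (b.coord s)).map (algebraMap K A) := by
    ext i j
    have hT : (b.repr (F i j)).support ⊆ T :=
      Finset.subset_biUnion_of_mem (fun p : m × n => (b.repr (F p.1 p.2)).support)
        (Finset.mem_univ (i, j))
    calc F i j = ∑ s ∈ T, b.repr (F i j) s • b s := by
          conv_lhs => rw [← b.linearCombination_repr (F i j), Finsupp.linearCombination_apply]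
          exact Finsupp.sum_of_support_subset _ hT _ (by simp)
      _ = (∑ s ∈ T, b s • (F.map (b.coord s)).map (algebraMap K A)) i j := by
          simp [Matrix.sum_apply, Algebra.smul_def, mul_comm]
  rw [hsum]
  refine Submodule.sum_mem _ fun s _ => Submodule.smul_mem _ _ (Submodule.subset_span ?_)
  rw [← hsum]
  exact ⟨b.coord s, rfl⟩

theorem linearMap_dotProduct_mulVec [Fintype m] [Fintype n] (f : A →ₗ[K] K) (F : Matrix m n A)
    (x : n → K) (y : m → K) :
    f ((algebraMap K A ∘ y) ⬝ᵥ F *ᵥ (algebraMap K A ∘ x)) = y ⬝ᵥ F.map f *ᵥ x := by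
  have hf (c : K) (z : A) : f (algebraMap K A c * z) = c * f z := by
    rw [← Algebra.smul_def, map_smul, smul_eq_mul]
  simp only [dotProduct, mulVec, Function.comp_apply, map_sum, map_apply, hf, mul_comm (F _ _),
    mul_comm (f _)]

theorem span_image_map_span (s : Set (Matrix m n K)) :
    Submodule.span A ((·.map (algebraMap K A)) '' (Submodule.span K s : Set (Matrix m n K))) =
      Submodule.span A ((·.map (algebraMap K A)) '' s) := by
  have himage := congrArg (SetLike.coe (B := Matrix m n A)) <|
    Submodule.map_span (Algebra.linearMap K A).mapMatrix s
  exact (congrArg (Submodule.span A) himage).trans (Submodule.span_span_of_tower K A _)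

theorem linearIndependent_pair_of_map [FaithfulSMul K A] {F G : Matrix m n K}
    (h : LinearIndependent A ![F.map (algebraMap K A), G.map (algebraMap K A)]) :
    LinearIndependent K ![F, G] := by
  refine LinearIndependent.of_comp (Algebra.linearMap K A).mapMatrix ?_
  convert h.restrict_scalars' K using 1
  ext i
  fin_cases i <;> rfl

end BaseChange

section Configurations

open Matrix

variable {K : Type*} [Field K]

theorem mulVec_rep_mk_eq_zero_iff {m n : Type*} [Fintype n] {F : Matrix m n K} {u : n → K}
    (hu : u ≠ 0) :
    F *ᵥ (Projectivization.mk K u hu).rep = 0 ↔ F *ᵥ u = 0 := by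
  obtain ⟨c, hc⟩ := Projectivization.exists_smul_eq_mk_rep K u hu
  rw [← hc, mulVec_smul, smul_eq_zero_iff_eq]

theorem mem_matrixSpace_mk_iff {n : ℕ} {u v : Fin n → Fin 3 → K} (hu : ∀ i, u i ≠ 0)
    (hv : ∀ i, v i ≠ 0) {F : Matrix (Fin 3) (Fin 3) K} :
    F ∈ matrixSpace (fun i => Projectivization.mk K (u i) (hu i))
      (fun i => Projectivization.mk K (v i) (hv i)) ↔ ∀ i, v i ⬝ᵥ F *ᵥ u i = 0 := by
  refine forall_congr' fun i => ?_
  obtain ⟨c, hc⟩ := Projectivization.exists_smul_eq_mk_rep K (u i) (hu i)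
  obtain ⟨d, hd⟩ := Projectivization.exists_smul_eq_mk_rep K (v i) (hv i)
  rw [← hc, ← hd, mulVec_smul, dotProduct_smul, smul_dotProduct, smul_eq_zero_iff_eq,
    smul_eq_zero_iff_eq]

/-- The fundamental matrix of two flatland cameras: the bilinear form whose value at `y` and `x` is
the determinant of the images `B y` and `A x` on the projective line. -/
def fundamentalMatrix (A B : Matrix (Fin 2) (Fin 3) K) : Matrix (Fin 3) (Fin 3) K :=
  Bᵀ * (!![0, 1; -1, 0] : Matrix (Fin 2) (Fin 2) K) * A

theorem dotProduct_fundamentalMatrix_mulVec (A B : Matrix (Fin 2) (Fin 3) K) (x y : Fin 3 → K) :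
    y ⬝ᵥ fundamentalMatrix A B *ᵥ x = (of ![B *ᵥ y, A *ᵥ x]).det := by
  rw [fundamentalMatrix, ← mulVec_mulVec, ← mulVec_mulVec, dotProduct_mulVec, vecMul_transpose,
    det_fin_two]
  simp only [dotProduct, mulVec, Fin.sum_univ_two, of_apply, cons_val]
  ring

theorem mulVec_surjective_of_rank_eq_card {m n : Type*} [Fintype m] [Fintype n] {A : Matrix m n K}
    (hA : A.rank = Fintype.card m) : Function.Surjective A.mulVec := by
  have hrange : LinearMap.range A.mulVecLin = ⊤ :=
    Submodule.eq_top_of_finrank_eq (hA.trans (Module.finrank_fintype_fun_eq_card K).symm)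
  exact LinearMap.range_eq_top.1 hrange

theorem fundamentalMatrix_ne_zero {A B : Matrix (Fin 2) (Fin 3) K} (hA : A.rank = 2)
    (hB : B.rank = 2) : fundamentalMatrix A B ≠ 0 := by
  intro h0
  obtain ⟨x, hx⟩ := mulVec_surjective_of_rank_eq_card hA ![0, 1]
  obtain ⟨y, hy⟩ := mulVec_surjective_of_rank_eq_card hB ![1, 0]
  have hxy := dotProduct_fundamentalMatrix_mulVec A B x y
  simp [h0, hx, hy] at hxy

theorem IsCenterPair.mem_centersVariety {n : ℕ} {X Y : Fin n → Plane K} {a b : Plane K}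
    (h : IsCenterPair X Y a b) : (a, b) ∈ centersVariety X Y := by
  obtain ⟨A, B, hA, hB, ha, hb, hAB⟩ := h
  refine ⟨fundamentalMatrix A B, fun i => ?_, fundamentalMatrix_ne_zero hA hB, ?_, ?_⟩
  · obtain ⟨-, -, c, -, hc⟩ := hAB i
    rw [dotProduct_fundamentalMatrix_mulVec, hc, det_fin_two]
    simp only [of_apply, cons_val, Pi.smul_apply, smul_eq_mul]
    ring
  · rw [fundamentalMatrix, ← mulVec_mulVec, ha, mulVec_zero]
  · rw [fundamentalMatrix, transpose_mul, transpose_mul, transpose_transpose, ← mulVec_mulVec,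
      ← mulVec_mulVec, hb, mulVec_zero, mulVec_zero]

variable [Algebra K ℂ]

theorem toComplex_injective : Function.Injective (toComplex (K := K)) := by
  intro a b h
  obtain ⟨c, hc⟩ := (Projectivization.mk_eq_mk_iff' ..).1 h
  obtain ⟨j, hj⟩ := Function.ne_iff.1 b.rep_nonzero
  rw [← a.mk_rep, ← b.mk_rep, Projectivization.mk_eq_mk_iff']
  have hj' : algebraMap K ℂ (b.rep j) ≠ 0 := by simpa using hj
  refine ⟨a.rep j / b.rep j, ?_⟩
  ext i
  apply (algebraMap K ℂ).injective
  have hi := congrFun hc i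
  have hj := congrFun hc j
  simp only [Pi.smul_apply, smul_eq_mul] at hi hj ⊢
  rw [map_mul, map_div₀, ← hi, ← hj, mul_div_cancel_right₀ _ hj']

theorem map_mulVec_toComplex_rep_eq_zero {F : Matrix (Fin 3) (Fin 3) K} {a : Plane K}
    (h : F *ᵥ a.rep = 0) : F.map (algebraMap K ℂ) *ᵥ (toComplex a).rep = 0 := by
  rw [toComplex, mulVec_rep_mk_eq_zero_iff]
  ext i
  simpa [h, Function.comp_def] using (RingHom.map_mulVec (algebraMap K ℂ) F a.rep i).symm

variable {n : ℕ} {X Y : Fin n → Plane K}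

theorem matrixSpace_toComplex (X Y : Fin n → Plane K) :
    matrixSpace (fun i => toComplex (X i)) (fun i => toComplex (Y i)) =
      Submodule.span ℂ
        ((·.map (algebraMap K ℂ)) '' (matrixSpace X Y : Set (Matrix (Fin 3) (Fin 3) K))) := by
  have hmem (F : Matrix (Fin 3) (Fin 3) ℂ) :
      F ∈ matrixSpace (fun i => toComplex (X i)) (fun i => toComplex (Y i)) ↔
        ∀ i, (algebraMap K ℂ ∘ (Y i).rep) ⬝ᵥ F *ᵥ (algebraMap K ℂ ∘ (X i).rep) = 0 :=
    mem_matrixSpace_mk_iff _ _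
  apply le_antisymm
  · -- a `K`-linear form applied to the entries of a complex solution gives a solution over `K`
    intro F hF
    refine Submodule.span_mono ?_ (mem_span_range_map_linearMap (K := K) F)
    rintro _ ⟨f, rfl⟩
    refine ⟨F.map f, fun i => ?_, rfl⟩
    rw [← linearMap_dotProduct_mulVec, (hmem F).1 hF i, map_zero]
  · rw [Submodule.span_le]
    rintro _ ⟨F, hF, rfl⟩
    refine (hmem _).2 fun i => ?_
    have hmap : F.map (algebraMap K ℂ) *ᵥ (algebraMap K ℂ ∘ (X i).rep) =
        algebraMap K ℂ ∘ (F *ᵥ (X i).rep) :=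
      funext fun j => (RingHom.map_mulVec (algebraMap K ℂ) F (X i).rep j).symm
    rw [hmap, ← RingHom.map_dotProduct, hF i, map_zero]

theorem span_map_pair_eq_matrixSpace {F G : Matrix (Fin 3) (Fin 3) K}
    (hspan : Submodule.span K {F, G} = matrixSpace X Y) :
    Submodule.span ℂ {F.map (algebraMap K ℂ), G.map (algebraMap K ℂ)} =
      matrixSpace (fun i => toComplex (X i)) (fun i => toComplex (Y i)) := by
  rw [matrixSpace_toComplex, ← hspan, span_image_map_span, Set.image_pair]

theorem IsCenterPair.toComplex_mem_complexCentersVariety {a b : Plane K}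
    (h : IsCenterPair X Y a b) : (toComplex a, toComplex b) ∈ complexCentersVariety X Y := by
  obtain ⟨F, hF, hF0, ha, hb⟩ := h.mem_centersVariety
  refine ⟨F.map (algebraMap K ℂ), ?_, fun h0 => hF0 ?_, map_mulVec_toComplex_rep_eq_zero ha, ?_⟩
  · rw [matrixSpace_toComplex]
    exact Submodule.subset_span ⟨F, hF, rfl⟩
  · exact map_injective (algebraMap K ℂ).injective (by simpa using h0)
  · rw [← transpose_map]
    exact map_mulVec_toComplex_rep_eq_zero hb

theorem encard_setOf_isCenterPair_le (X Y : Fin n → Plane K) :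
    {p : Plane K × Plane K | IsCenterPair X Y p.1 p.2}.encard ≤
      (complexCentersVariety X Y).encard := by
  rw [← (toComplex_injective.prodMap toComplex_injective).encard_image]
  refine Set.encard_le_encard ?_
  rintro _ ⟨⟨a, b⟩, h, rfl⟩
  exact h.toComplex_mem_complexCentersVariety

end Configurations

section Conics

variable {K : Type*} [Field K]

theorem linearForms_isHomogeneous (F : Matrix (Fin 3) (Fin 3) K) (i : Fin 3) :
    (linearForms F i).IsHomogeneous 1 := by
  simp only [linearForms, Matrix.mulVec, dotProduct, Matrix.map_apply]
  exact .sum _ _ _ fun j _ => (MvPolynomial.isHomogeneous_X K j).C_mul _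

theorem crossConics_isHomogeneous (F G : Matrix (Fin 3) (Fin 3) K) (i : Fin 3) :
    (crossConics F G i).IsHomogeneous 2 := by
  have hminor (a b c d : Fin 3) : (linearForms F a * linearForms G b -
      linearForms F c * linearForms G d).IsHomogeneous 2 :=
    ((linearForms_isHomogeneous F a).mul (linearForms_isHomogeneous G b)).sub
      ((linearForms_isHomogeneous F c).mul (linearForms_isHomogeneous G d))
  rw [crossConics, cross_apply]
  fin_cases i <;> exact hminor _ _ _ _

variable [Algebra K ℂ]

theorem aeval_linearForms (F : Matrix (Fin 3) (Fin 3) K) (z : Fin 3 → ℂ) (i : Fin 3) :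
    MvPolynomial.aeval z (linearForms F i) = (F.map (algebraMap K ℂ) *ᵥ z) i := by
  simp [linearForms, Matrix.mulVec, dotProduct]

theorem aeval_crossConics (F G : Matrix (Fin 3) (Fin 3) K) (z : Fin 3 → ℂ) (i : Fin 3) :
    MvPolynomial.aeval z (crossConics F G i) =
      ((F.map (algebraMap K ℂ) *ᵥ z) ⨯₃ (G.map (algebraMap K ℂ) *ᵥ z)) i := by
  rw [crossConics, cross_apply, cross_apply]
  fin_cases i <;> simp [aeval_linearForms]

theorem complexIntersection_crossConics (F G : Matrix (Fin 3) (Fin 3) K) :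
    complexIntersection (crossConics F G) =
      {a | (F.map (algebraMap K ℂ) *ᵥ a.rep) ⨯₃ (G.map (algebraMap K ℂ) *ᵥ a.rep) = 0} := by
  ext a
  simp [complexIntersection, aeval_crossConics, funext_iff]

theorem isConicTriple_crossConics {F G : Matrix (Fin 3) (Fin 3) K}
    (h : IsSplitPencil (F.map (algebraMap K ℂ)) (G.map (algebraMap K ℂ))) :
    IsConicTriple (crossConics F G) := by
  have hli : LinearIndependent K (crossConics F G) := by
    rw [Fintype.linearIndependent_iff]
    intro c hc
    have hc0 : (fun i => algebraMap K ℂ (c i)) = 0 :=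
      h.eq_zero_of_dotProduct_crossProduct fun z => by
        have hz := congrArg (MvPolynomial.aeval z) hc
        simpa [aeval_crossConics, Algebra.smul_def, dotProduct] using hz
    intro i
    simpa using congrFun hc0 i
  refine ⟨fun i => ⟨crossConics_isHomogeneous F G i, hli.ne_zero i⟩, fun i j hij => ?_⟩
  convert hli.comp ![i, j] (injective_pair_iff_ne.2 hij) using 1
  ext x
  fin_cases x <;> rfl

end Conics

section SplitConfiguration

variable {K : Type*} [Field K] [Algebra K ℂ] {n : ℕ}

/-- The matrices `F` with `yᵢᵀ F xᵢ = 0` form a pencil that splits over `ℂ`. This is the genericity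
condition on a configuration. -/
def IsSplitConfiguration (X Y : Fin n → Plane K) : Prop :=
  ∃ F G : Matrix (Fin 3) (Fin 3) K, Submodule.span K {F, G} = matrixSpace X Y ∧
    IsSplitPencil (F.map (algebraMap K ℂ)) (G.map (algebraMap K ℂ))

namespace IsSplitConfiguration

variable {X Y : Fin n → Plane K}

theorem finrank_matrixSpace (h : IsSplitConfiguration X Y) :
    Module.finrank K (matrixSpace X Y) = 2 := by
  obtain ⟨F, G, hspan, hsplit⟩ := h
  have hFG := finrank_span_eq_card (linearIndependent_pair_of_map hsplit.linearIndependent)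
  rwa [Matrix.range_cons_cons_empty, hspan, Fintype.card_fin] at hFG

theorem isSplitPencil_map (h : IsSplitConfiguration X Y) {F G : Matrix (Fin 3) (Fin 3) K}
    (hspan : Submodule.span K {F, G} = matrixSpace X Y) :
    IsSplitPencil (F.map (algebraMap K ℂ)) (G.map (algebraMap K ℂ)) := by
  obtain ⟨F', G', hspan', hsplit⟩ := h
  exact hsplit.of_span_eq <|
    (span_map_pair_eq_matrixSpace hspan).trans (span_map_pair_eq_matrixSpace hspan').symm

theorem exists_complexCentersVariety_eq (h : IsSplitConfiguration X Y) :
    ∃ F G : Matrix (Fin 3) (Fin 3) ℂ, IsSplitPencil F G ∧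
      complexCentersVariety X Y = kernelPairs (Submodule.span ℂ {F, G}) := by
  obtain ⟨F, G, hspan, hsplit⟩ := h
  exact ⟨_, _, hsplit, congrArg kernelPairs (span_map_pair_eq_matrixSpace hspan).symm⟩

theorem encard_complexCentersVariety (h : IsSplitConfiguration X Y) :
    (complexCentersVariety X Y).encard = 3 := by
  obtain ⟨F, G, hsplit, hV⟩ := h.exists_complexCentersVariety_eq
  rw [hV, hsplit.encard_kernelPairs]
  rfl

theorem injOn_fst (h : IsSplitConfiguration X Y) :
    Set.InjOn Prod.fst (complexCentersVariety X Y) := by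
  obtain ⟨F, G, hsplit, hV⟩ := h.exists_complexCentersVariety_eq
  exact hV ▸ hsplit.injOn_fst_kernelPairs

theorem injOn_snd (h : IsSplitConfiguration X Y) :
    Set.InjOn Prod.snd (complexCentersVariety X Y) := by
  obtain ⟨F, G, hsplit, hV⟩ := h.exists_complexCentersVariety_eq
  exact hV ▸ hsplit.injOn_snd_kernelPairs

theorem complexIntersection_crossConics_eq (h : IsSplitConfiguration X Y)
    {F G : Matrix (Fin 3) (Fin 3) K} (hspan : Submodule.span K {F, G} = matrixSpace X Y) :
    complexIntersection (crossConics F G) = Prod.fst '' complexCentersVariety X Y := by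
  rw [complexIntersection_crossConics, ← (h.isSplitPencil_map hspan).image_fst_kernelPairs_eq,
    span_map_pair_eq_matrixSpace hspan]
  rfl

theorem complexIntersection_crossConics_transpose_eq (h : IsSplitConfiguration X Y)
    {F G : Matrix (Fin 3) (Fin 3) K} (hspan : Submodule.span K {F, G} = matrixSpace X Y) :
    complexIntersection (crossConics Fᵀ Gᵀ) = Prod.snd '' complexCentersVariety X Y := by
  rw [complexIntersection_crossConics, Matrix.transpose_map, Matrix.transpose_map,
    ← (h.isSplitPencil_map hspan).image_snd_kernelPairs_eq, span_map_pair_eq_matrixSpace hspan]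
  rfl

end IsSplitConfiguration

theorem HoldsGenerically.mono {K : Type*} [Field K] {n : ℕ}
    {P Q : (Fin n → Plane K) → (Fin n → Plane K) → Prop} (hP : HoldsGenerically n P)
    (hPQ : ∀ X Y, P X Y → Q X Y) : HoldsGenerically n Q := by
  obtain ⟨Δ, hΔ, hΔP⟩ := hP
  exact ⟨Δ, hΔ, fun u v hu hv h => hPQ _ _ (hΔP u v hu hv h)⟩

theorem isSplitConfiguration_mk {u v : Fin 7 → Fin 3 → K} (hu : ∀ i, u i ≠ 0) (hv : ∀ i, v i ≠ 0)
    (h : systemDiscr u v ≠ 0) :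
    IsSplitConfiguration (fun i => Projectivization.mk K (u i) (hu i))
      (fun i => Projectivization.mk K (v i) (hv i)) := by
  refine ⟨systemSolution u v 0, systemSolution u v 1, ?_, ?_⟩
  · ext F
    rw [mem_matrixSpace_mk_iff hu hv]
    exact mem_span_systemSolution_iff (left_ne_zero_of_mul h).isUnit
  · rw [map_systemSolution, map_systemSolution]
    apply isSplitPencil_of_pencilDiscr_ne_zero
    rw [← map_systemSolution, ← map_systemSolution, ← map_pencilDiscr]
    exact (map_ne_zero _).2 (right_ne_zero_of_mul h)

theorem holdsGenerically_isSplitConfiguration (K : Type*) [Field K] [Algebra K ℂ] :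
    HoldsGenerically 7 (IsSplitConfiguration (K := K)) := by
  have : CharZero K := (algebraMap K ℂ).charZero
  have heval (u v : Fin 7 → Fin 3 → K) :
      MvPolynomial.eval (Sum.elim (fun s => u s.1 s.2) (fun s => v s.1 s.2))
        (systemDiscr (fun i j => MvPolynomial.X (Sum.inl (i, j)))
          (fun i j => MvPolynomial.X (Sum.inr (i, j)))) = systemDiscr u v := by
    rw [map_systemDiscr]
    congr 1 <;> ext i j <;> simp
  obtain ⟨u, v, huv⟩ := exists_systemDiscr_ne_zero K
  exact ⟨_, fun h0 => huv (by rw [← heval, h0, map_zero]), fun u v hu hv h =>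
    isSplitConfiguration_mk hu hv (heval u v ▸ h)⟩

theorem hasMultidegree_zero_zero {V : Set (Plane ℂ × Plane ℂ)} {d : ℕ} (h : V.encard = d) :
    HasMultidegree V 0 0 d :=
  ⟨1, one_ne_zero, fun l m _ => by simpa using h⟩

end SplitConfiguration

end FlatlandCameras

/-- `K` is a field of definition of the data inside `ℂ`; the cases of interest are `ℝ` and `ℂ`. -/
theorem mainTheorem6 (K : Type*) [Field K] [Algebra K ℂ] :
    HoldsGenerically 7 fun X Y : Fin 7 → Plane K =>
      -- the conics are computed from any basis of the two-dimensional solution space of the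
      -- linear system given by the data
      Module.finrank K (matrixSpace X Y) = 2 ∧
      (∀ F₁ F₂ : Matrix (Fin 3) (Fin 3) K, LinearIndependent K ![F₁, F₂] →
        Submodule.span K {F₁, F₂} = matrixSpace X Y →
        IsConicTriple (crossConics F₁ F₂) ∧
        IsConicTriple (crossConics F₁ᵀ F₂ᵀ) ∧
        (∀ a b, IsCenterPair X Y a b →
          toComplex a ∈ complexIntersection (crossConics F₁ F₂) ∧
          toComplex b ∈ complexIntersection (crossConics F₁ᵀ F₂ᵀ)) ∧
        (complexIntersection (crossConics F₁ F₂)).encard = 3 ∧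
        (complexIntersection (crossConics F₁ᵀ F₂ᵀ)).encard = 3 ∧
        (∀ a b, (a, b) ∈ complexCentersVariety X Y → a ∈ complexIntersection (crossConics F₁ F₂) ∧
          b ∈ complexIntersection (crossConics F₁ᵀ F₂ᵀ)) ∧
        (∀ a ∈ complexIntersection (crossConics F₁ F₂), ∃! b, (a, b) ∈ complexCentersVariety X Y) ∧
        (∀ b ∈ complexIntersection (crossConics F₁ᵀ F₂ᵀ), ∃! a, (a, b) ∈ complexCentersVariety X Y)) ∧
      -- one center determines the other
      (∀ a b b', IsCenterPair X Y a b →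
        IsCenterPair X Y a b' → b = b') ∧
      (∀ a a' b, IsCenterPair X Y a b →
        IsCenterPair X Y a' b → a = a') ∧
      -- the camera centers variety
      (∀ a b, IsCenterPair X Y a b →
        (toComplex a, toComplex b) ∈ complexCentersVariety X Y) ∧
      (complexCentersVariety X Y).encard = 3 ∧ HasMultidegree (complexCentersVariety X Y) 0 0 3 ∧
      {p : Plane K × Plane K |
        IsCenterPair X Y p.1 p.2}.encard ≤ 3 := by
  refine (holdsGenerically_isSplitConfiguration K).mono fun X Y h => ?_
  have hE (a b : Plane K) (hab : IsCenterPair X Y a b) := hab.toComplex_mem_complexCentersVariety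
  refine ⟨h.finrank_matrixSpace, fun F₁ F₂ _ hspan => ?_,
    fun a b b' hab hab' => ?_, fun a a' b hab hab' => ?_, hE, h.encard_complexCentersVariety,
    hasMultidegree_zero_zero h.encard_complexCentersVariety,
    (encard_setOf_isCenterPair_le X Y).trans_eq h.encard_complexCentersVariety⟩
  · have hsplit := h.isSplitPencil_map hspan
    rw [h.complexIntersection_crossConics_eq hspan,
      h.complexIntersection_crossConics_transpose_eq hspan, h.injOn_fst.encard_image,
      h.injOn_snd.encard_image]
    refine ⟨isConicTriple_crossConics hsplit, isConicTriple_crossConics hsplit.transpose,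
      fun a b hab => ⟨⟨_, hE a b hab, rfl⟩, ⟨_, hE a b hab, rfl⟩⟩,
      h.encard_complexCentersVariety, h.encard_complexCentersVariety,
      fun a b hab => ⟨⟨_, hab, rfl⟩, ⟨_, hab, rfl⟩⟩, ?_, ?_⟩
    · rintro _ ⟨⟨a, b⟩, hab, rfl⟩
      exact ⟨b, hab, fun b' hab' => (Prod.mk.inj (h.injOn_fst hab' hab rfl)).2⟩
    · rintro _ ⟨⟨a, b⟩, hab, rfl⟩
      exact ⟨a, hab, fun a' hab' => (Prod.mk.inj (h.injOn_snd hab' hab rfl)).1⟩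
  · exact toComplex_injective (Prod.mk.inj (h.injOn_fst (hE a b hab) (hE a b' hab') rfl)).2
  · exact toComplex_injective (Prod.mk.inj (h.injOn_snd (hE a b hab) (hE a' b hab') rfl)).1
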